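/- Let $0<q\le p$ with $p^2+q^2<1$, and suppose that there is $\tilde\delta\in(0,1)$ such that $$\mathcal S_{p,q}(\delta):=p^{2+\delta}+q^{2+\delta}-1-\frac{2+\delta}{2}\,(p^2+q^2-1)<0\qquad\text{for all }0<\delta<\tilde\delta .$$ Let $g_0\ge 0$ be a probability density on $\mathbb R$ with $$\int_{\mathbb R} v\,g_0(v)\,dv=0,\qquad \int_{\mathbb R} v^2g_0(v)\,dv=1,\qquad \int_{\mathbb R}|v|^{2+\tilde\delta}g_0(v)\,dv<\infty .$$ Write $\hat\varphi(\xi)=\int_{\mathbb R}e^{-i\xi v}\varphi(v)\,dv$, and suppose that for some $R,\nu,\beta>0$ $$|\hat g_0(\xi)|\le \frac{1}{(1+\beta|\xi|)^{\nu}}\qquad\text{for } |\xi|>R .$$ Let $f$ be the weak solution, with initial density $g_0$, of the one-dimensional dissipative Maxwell model with collision rule $v^*=pv+qw$. That is, $f(\cdot,0)=g_0$ a.e., $f(\cdot,t)$ is nonnegative and integrable for every $t\ge0$, and for every bounded continuous $\Phi:\mathbb R\to\mathbb R$ $$\frac{d}{dt}\int_{\mathbb R}\Phi(v)f(v,t)\,dv=\iint_{\mathbb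 R^2}f(v,t)f(w,t)\bigl(\Phi(pv+qw)-\Phi(v)\bigr)\,dw\,dv\quad(t>0),$$ $$\lim_{t\to0^+}\int_{\mathbb R}\Phi(v)f(v,t)\,dv=\int_{\mathbb R}\Phi(v)g_0(v)\,dv .$$ Let $g(v,t)=\sqrt{E(t)}\,f\bigl(v\sqrt{E(t)},t\bigr)$ with $E(t)=e^{(p^2+q^2-1)t}$ be the scaled solution, so that $$\partial_t\hat g(\xi,t)+\tfrac12(p^2+q^2-1)\,\xi\,\partial_\xi\hat g(\xi,t)=\hat g(p\xi,t)\,\hat g(q\xi,t)-\hat g(\xi,t),\qquad \hat g(\xi,0)=\hat g_0(\xi).$$ Then there exist constants $\rho>0$, $k>0$, $\beta'>0$ and $\nu'>0$, independent of $t$, such that for all $t\ge 0$ $$|\hat g(\xi,t)|\le \frac{1}{1+k\xi^2}\quad\text{if } |\xi|\le\rho,\qquad\qquad |\hat g(\xi,t)|\le\frac{1}{(1+\beta'|\xi|)^{\nu'}}\quad\text{if } |\xi|>\rho .$$ -/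

import Mathlib

open MeasureTheory Filter Topology
open scoped BoundedContinuousFunction

noncomputable section

namespace DissipativeMaxwell

/-- The function `S_{p,q}(δ) = p^(2+δ) + q^(2+δ) - 1 - ((2+δ)/2) (p² + q² - 1)`. -/
def spectralS (p q δ : ℝ) : ℝ :=
  p ^ (2 + δ) + q ^ (2 + δ) - 1 - (2 + δ) / 2 * (p ^ 2 + q ^ 2 - 1)

/-- The Fourier transform (no factor `2π`), `φ̂(ξ) = ∫ e^{-iξv} φ(v) dv`. -/
def hat (φ : ℝ → ℝ) (ξ : ℝ) : ℂ :=
  ∫ v : ℝ, Complex.exp (-(Complex.I * (ξ : ℂ) * (v : ℂ))) * (φ v : ℂ)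

/-- A normalized density on the line: a probability density with mean `0` and
second moment `1`. -/
structure IsNormalizedDensity (φ : ℝ → ℝ) : Prop where
  nonneg : ∀ᵐ v : ℝ, 0 ≤ φ v
  integrable : Integrable φ
  integrable_mean : Integrable fun v : ℝ => v * φ v
  integrable_energy : Integrable fun v : ℝ => v ^ 2 * φ v
  mass : ∫ v : ℝ, φ v = 1
  mean : ∫ v : ℝ, v * φ v = 0
  energy : ∫ v : ℝ, v ^ 2 * φ v = 1

/-- `f` (written `f t v`, with time `t ≥ 0` and velocity `v`) is a weak solution of the
Boltzmann equation with collision rule `v* = p v + q w` and initial density `f₀`: every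
`f t` is a nonnegative integrable function and, for all bounded continuous `Φ`,
`d/dt ∫ Φ(v) f(v,t) dv = ∬ f(v,t) f(w,t) (Φ(p v + q w) - Φ(v)) dw dv` for `t > 0`, and
`∫ Φ(v) f(v,t) dv → ∫ Φ(v) f₀(v) dv` as `t → 0⁺`. -/
structure IsWeakSolution (p q : ℝ) (f₀ : ℝ → ℝ) (f : ℝ → ℝ → ℝ) : Prop where
  nonneg : ∀ t, 0 ≤ t → ∀ᵐ v : ℝ, 0 ≤ f t v
  integrable : ∀ t, 0 ≤ t → Integrable (f t)
  weak_form : ∀ Φ : ℝ →ᵇ ℝ, ∀ t, 0 < t →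
    HasDerivAt (fun s => ∫ v : ℝ, Φ v * f s v)
      (∫ v : ℝ, ∫ w : ℝ, f t v * f t w * (Φ (p * v + q * w) - Φ v)) t
  initial : f 0 =ᵐ[volume] f₀
  initial_limit : ∀ Φ : ℝ →ᵇ ℝ,
    Tendsto (fun t => ∫ v : ℝ, Φ v * f t v) (𝓝[>] 0) (𝓝 (∫ v : ℝ, Φ v * f₀ v))

/-- The energy `E(t) = exp((p² + q² - 1) t)` at time `t` of the solution starting from a
normalized density. -/
def energy (p q t : ℝ) : ℝ := Real.exp ((p ^ 2 + q ^ 2 - 1) * t)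

/-- The scaled solution `g(v,t) = √E(t) f(v √E(t), t)`. On the Fourier side the equation
for `f` becomes
`∂ₜ ĝ + ½ (p² + q² - 1) ξ ∂_ξ ĝ = ĝ(pξ,t) ĝ(qξ,t) - ĝ(ξ,t)`. -/
def scaled (p q : ℝ) (f : ℝ → ℝ → ℝ) (t v : ℝ) : ℝ :=
  √(energy p q t) * f t (v * √(energy p q t))

end DissipativeMaxwell

end

open DissipativeMaxwell

/-!
# Uniform Fourier decay for the scaled dissipative Maxwell model

In Fourier variables a weak solution satisfies, separately for each frequency,
`∂ₜ F(ξ) = F(pξ) F(qξ) - F(ξ)` with `‖F‖ ≤ 1` (`IsWeakSolution.isFourierSolution`), and the scaled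
solution at frequency `ξ` is `F t (ξ exp (λ t))` with `λ = coolingRate p q` (`hat_scaled`). All
estimates on `F` come from one comparison principle for `u' = G - u` (`norm_le_of_relaxation`).

*Low frequencies.* The Gaussian `exp (-r² / 2)` of the scaled frequency `r = |ξ| exp (-λ t)`
solves the equation up to a defect `O(r ^ (2 + δ))`. As `spectralS p q δ < 0`, the function
`K r ^ (2 + δ)` is a supersolution of the equation for the difference, and bounds it for all times
(`IsFourierSolution.norm_sub_gaussian_le`); initially it does so because of the moment of order
`2 + δ`. Hence the scaled solution is at most `1 / (1 + r² / 8)` for `r ≤ ρ`, uniformly in time.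

*High frequencies.* A decreasing barrier for `‖F‖` beyond `ρ` propagates if it is consistent with
the gain term `F(pξ) F(qξ)`; because `p < 1`, this can be proved by induction on the scale of `ξ`
(`IsFourierSolution.propagate`). A constant `c < 1` comes first, starting from the fact that the
initial Fourier transform stays away from `1` outside a neighbourhood of `0`
(`exists_norm_hat_le_of_decay`). The factor `‖F(qξ)‖ ≤ c` then beats the loss `p ^ (-ν')` suffered
by `(1 + β' r) ^ (-ν')` under `r ↦ p r` once `ν'` is small, which gives the polynomial decay
(`IsFourierSolution.norm_le_rpow`).
-/

namespace DissipativeMaxwell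

/-! ### Comparison for relaxation equations -/

/-- Comparison principle for the relaxation equation `u' = G - u`: a real function `b` with
`‖u 0‖ ≤ b 0` and `‖G‖ ≤ b + b'` dominates `‖u‖`. For a unimodular `w` the function
`eᵗ (b - Re (w u))` is nondecreasing; `w` is chosen to rotate `u T` onto the positive half-line. -/
theorem norm_le_of_relaxation {u G : ℝ → ℂ} {b b' : ℝ → ℝ} {T : ℝ} (hT : 0 ≤ T)
    (hu : ContinuousOn u (Set.Icc 0 T))
    (hu' : ∀ t ∈ Set.Ioo 0 T, HasDerivAt u (G t - u t) t)
    (hb : ∀ t, HasDerivAt b (b' t) t) (h0 : ‖u 0‖ ≤ b 0)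
    (hG : ∀ t ∈ Set.Ioo 0 T, ‖G t‖ ≤ b t + b' t) : ‖u T‖ ≤ b T := by
  obtain ⟨w, hw, hwu⟩ : ∃ w : ℂ, ‖w‖ = 1 ∧ (w * u T).re = ‖u T‖ := by
    obtain ⟨w, hw, h⟩ := RCLike.exists_norm_eq_mul_self (u T)
    exact ⟨w, hw, by rw [← h]; simp⟩
  have hre : ∀ z : ℂ, (w * z).re ≤ ‖z‖ := fun z => by
    simpa [hw] using Complex.re_le_norm (w * z)
  have hder : ∀ t ∈ Set.Ioo 0 T, HasDerivAt (fun s => Real.exp s * (b s - (w * u s).re))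
      (Real.exp t * (b t - (w * u t).re) + Real.exp t * (b' t - (w * (G t - u t)).re)) t := by
    intro t ht
    have h1 : HasDerivAt (fun s => (w * u s).re) (w * (G t - u t)).re t :=
      Complex.reCLM.hasFDerivAt.comp_hasDerivAt t ((hu' t ht).const_mul w)
    exact (Real.hasDerivAt_exp t).mul ((hb t).sub h1)
  have hmono : MonotoneOn (fun s => Real.exp s * (b s - (w * u s).re)) (Set.Icc 0 T) := by
    apply monotoneOn_of_deriv_nonneg (convex_Icc 0 T)
    · have hbc : Continuous b := continuous_iff_continuousAt.2 fun t => (hb t).continuousAt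
      exact Real.continuous_exp.continuousOn.mul (hbc.continuousOn.sub
        (Complex.continuous_re.comp_continuousOn (continuousOn_const.mul hu)))
    · rw [interior_Icc]
      exact fun t ht => (hder t ht).differentiableAt.differentiableWithinAt
    · rw [interior_Icc]
      intro t ht
      rw [(hder t ht).deriv, mul_sub w, Complex.sub_re, ← mul_add]
      have h1 := hre (G t)
      have h2 := hG t ht
      exact mul_nonneg (Real.exp_pos t).le (by linarith)
  have h := hmono (Set.left_mem_Icc.2 hT) (Set.right_mem_Icc.2 hT) hT
  simp only [Real.exp_zero, one_mul] at h
  have h1 := hre (u 0)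
  have h2 : 0 ≤ Real.exp T * (b T - (w * u T).re) := by linarith
  have h3 := nonneg_of_mul_nonneg_right h2 (Real.exp_pos T)
  linarith

/-! ### The Fourier equation and propagation of barriers -/

/-- `F t ξ` is a bounded solution, for each frequency `ξ` continuous up to `t = 0`, of the Maxwell
equation in Fourier variables `∂ₜ F(ξ) = F(pξ) F(qξ) - F(ξ)`. Nothing is assumed about regularity
in `ξ`, nor that `F t` is a characteristic function. -/
structure IsFourierSolution (p q : ℝ) (F : ℝ → ℝ → ℂ) : Prop where
  norm_le_one : ∀ t, 0 ≤ t → ∀ ξ, ‖F t ξ‖ ≤ 1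
  continuousOn : ∀ ξ, ContinuousOn (fun t => F t ξ) (Set.Ici 0)
  hasDerivAt : ∀ ξ t, 0 < t →
    HasDerivAt (fun s => F s ξ) (F t (p * ξ) * F t (q * ξ) - F t ξ) t

/-- The rate `λ = (1 - p² - q²) / 2` at which typical velocities shrink, so that
`√(energy p q t) = exp (-λ t)`. The scaled solution at frequency `η` is the unscaled one at
`η exp (λ t)`; equivalently `|ξ| exp (-λ t)` is the scaled size of the frequency `ξ`. -/
noncomputable def coolingRate (p q : ℝ) : ℝ := (1 - p ^ 2 - q ^ 2) / 2

/-- A decreasing barrier `V` for `‖F‖` on scaled frequencies larger than `ρ` propagates in time as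
soon as it bounds the initial datum and the gain term `F(pξ) F(qξ)`, where in the latter check the
barrier may already be used at the smaller frequency `pξ`. The induction is on the number of
multiplications by `p` that bring `ξ` below `ρ`. -/
theorem IsFourierSolution.propagate {p q ρ : ℝ} {F : ℝ → ℝ → ℂ} (hF : IsFourierSolution p q F)
    (hp : 0 < p) (hp1 : p < 1) (hρ : 0 < ρ) {r : ℝ} (hr : 0 ≤ r) {V : ℝ → ℝ}
    (hV : AntitoneOn V (Set.Ioi ρ)) (h0 : ∀ ξ, ρ < |ξ| → ‖F 0 ξ‖ ≤ V |ξ|)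
    (hstep : ∀ t, 0 ≤ t → ∀ ξ, ρ < |ξ| * Real.exp (-(r * t)) →
      (ρ < p * (|ξ| * Real.exp (-(r * t))) →
        ‖F t (p * ξ)‖ ≤ V (p * (|ξ| * Real.exp (-(r * t))))) →
      ‖F t (p * ξ) * F t (q * ξ)‖ ≤ V (|ξ| * Real.exp (-(r * t))))
    {t : ℝ} (ht : 0 ≤ t) {ξ : ℝ} (hξ : ρ < |ξ| * Real.exp (-(r * t))) :
    ‖F t ξ‖ ≤ V (|ξ| * Real.exp (-(r * t))) := by
  obtain ⟨n, hn⟩ : ∃ n : ℕ, |ξ| * p ^ n ≤ ρ := by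
    have h : Tendsto (fun n : ℕ => |ξ| * p ^ n) atTop (𝓝 (|ξ| * 0)) :=
      (tendsto_pow_atTop_nhds_zero_of_lt_one hp.le hp1).const_mul _
    rw [mul_zero] at h
    exact ((h.eventually (gt_mem_nhds hρ)).exists).imp fun _ h => le_of_lt h
  induction n generalizing ξ t with
  | zero =>
    have h1 : Real.exp (-(r * t)) ≤ 1 := Real.exp_le_one_iff.2 (by nlinarith)
    have h2 : |ξ| * Real.exp (-(r * t)) ≤ |ξ| * 1 := by gcongr
    simp only [pow_zero] at hn
    linarith
  | succ n ih =>
    have hanti : ∀ s ∈ Set.Icc 0 t,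
        |ξ| * Real.exp (-(r * t)) ≤ |ξ| * Real.exp (-(r * s)) := by
      intro s hs
      gcongr
      exact hs.2
    -- The scaled size of `ξ` decreases in time, so the value of `V` at the final time bounds all
    -- earlier ones and serves as a constant barrier on `[0, t]`.
    have key := norm_le_of_relaxation (u := fun s => F s ξ)
      (G := fun s => F s (p * ξ) * F s (q * ξ))
      (b := fun _ => V (|ξ| * Real.exp (-(r * t)))) (b' := fun _ => 0) ht
      ((hF.continuousOn ξ).mono Set.Icc_subset_Ici_self)
      (fun s hs => hF.hasDerivAt ξ s hs.1) (fun s => hasDerivAt_const s _) ?_ ?_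
    · exact key
    · have h := hanti 0 ⟨le_rfl, ht⟩
      simp only [mul_zero, neg_zero, Real.exp_zero, mul_one] at h
      exact (h0 ξ (hξ.trans_le h)).trans (hV hξ (hξ.trans_le h) h)
    · intro s hs
      have h := hanti s (Set.Ioo_subset_Icc_self hs)
      rw [add_zero]
      refine (hstep s hs.1.le ξ (hξ.trans_le h) fun hlt => ?_).trans (hV hξ (hξ.trans_le h) h)
      have e : p * (|ξ| * Real.exp (-(r * s))) = |p * ξ| * Real.exp (-(r * s)) := by
        rw [abs_mul, abs_of_pos hp, mul_assoc]
      rw [e] at hlt ⊢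
      refine ih hs.1.le hlt ?_
      rw [abs_mul, abs_of_pos hp]
      rw [pow_succ] at hn
      linarith

/-! ### Distance to the shrinking Gaussian -/

/-- The defect of the shrinking Gaussian in the Fourier equation, with `c = 2λ` and `r` the scaled
frequency: the terms of order `r²` cancel, so the defect is `O(min (1, r⁴))`. -/
theorem gaussian_residual_le {r δ c : ℝ} (hr : 0 ≤ r) (hδ : 0 ≤ δ) (hδ2 : δ ≤ 2)
    (hc : 0 ≤ c) (hc1 : c ≤ 1) :
    |Real.exp (-((1 - c) * (r ^ 2 / 2))) - Real.exp (-(r ^ 2 / 2))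
      - c * r ^ 2 / 2 * Real.exp (-(r ^ 2 / 2))| ≤ r ^ (2 + δ) := by
  set z := r ^ 2 / 2 with hz
  have hz0 : 0 ≤ z := by positivity
  have e1 : Real.exp (-((1 - c) * z)) - Real.exp (-z) - c * r ^ 2 / 2 * Real.exp (-z)
      = Real.exp (-z) * (Real.exp (c * z) - 1 - c * z) := by
    have : Real.exp (-((1 - c) * z)) = Real.exp (-z) * Real.exp (c * z) := by
      rw [← Real.exp_add]; ring_nf
    rw [this, hz]; ring
  have hcz : 0 ≤ c * z := mul_nonneg hc hz0
  have hnn : 0 ≤ Real.exp (c * z) - 1 - c * z := by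
    have := Real.add_one_le_exp (c * z); linarith
  rw [e1, abs_of_nonneg (mul_nonneg (Real.exp_pos _).le hnn)]
  rcases le_total r 1 with h1 | h1
  · have hcz' : c * z ≤ z := mul_le_of_le_one_left hz0 hc1
    have hz1 : z ≤ 1 := by rw [hz]; nlinarith
    have h2 : Real.exp (c * z) - 1 - c * z ≤ (c * z) ^ 2 := by
      have := Real.abs_exp_sub_one_sub_id_le (x := c * z) (by rw [abs_of_nonneg hcz]; linarith)
      exact (le_abs_self _).trans this
    have h3 : r ^ (4 : ℝ) ≤ r ^ (2 + δ) := by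
      rcases hr.eq_or_lt with h | h
      · subst h
        rw [Real.zero_rpow (by norm_num), Real.zero_rpow (by linarith)]
      · exact Real.rpow_le_rpow_of_exponent_ge h h1 (by linarith)
    have h4 : r ^ (4 : ℝ) = r ^ (4 : ℕ) := Real.rpow_natCast r 4
    rw [h4] at h3
    have h5 : (c * z) ^ 2 ≤ z ^ 2 := by gcongr
    have h6 : z ^ 2 ≤ r ^ 4 := by rw [hz]; nlinarith [pow_nonneg hr 4]
    calc Real.exp (-z) * (Real.exp (c * z) - 1 - c * z)
        ≤ 1 * (Real.exp (c * z) - 1 - c * z) := by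
          gcongr; exact Real.exp_le_one_iff.2 (by linarith)
      _ ≤ r ^ (2 + δ) := (one_mul _).trans_le (h2.trans (h5.trans (h6.trans h3)))
  · have h2 : (1 : ℝ) ≤ r ^ (2 + δ) := Real.one_le_rpow h1 (by linarith)
    have h3 : Real.exp (-z) * (Real.exp (c * z) - 1 - c * z) ≤ Real.exp (-z) * Real.exp z := by
      gcongr
      have : Real.exp (c * z) ≤ Real.exp z :=
        Real.exp_le_exp.2 (mul_le_of_le_one_left hz0 hc1)
      linarith
    rw [← Real.exp_add, neg_add_cancel, Real.exp_zero] at h3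
    linarith

theorem spectralS_eq (p q δ : ℝ) :
    spectralS p q δ = p ^ (2 + δ) + q ^ (2 + δ) - (1 - coolingRate p q * (2 + δ)) := by
  unfold spectralS coolingRate; ring

/-- A solution stays within `K r ^ (2 + δ)` of the shrinking Gaussian, `r` being the scaled
frequency, if it does so initially. The condition `spectralS p q δ < 0` says exactly that
`r ^ (2 + δ)` is a strict supersolution of the linearized equation; the gain `K * -spectralS p q δ`
absorbs the defect of the Gaussian. -/
theorem IsFourierSolution.norm_sub_gaussian_le {p q δ K : ℝ} {F : ℝ → ℝ → ℂ}
    (hF : IsFourierSolution p q F) (hp : 0 < p) (hq : 0 < q) (hpq : p ^ 2 + q ^ 2 < 1)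
    (hδ : 0 ≤ δ) (hδ2 : δ ≤ 2) (hK0 : 0 ≤ K) (hK : 1 ≤ K * -spectralS p q δ)
    (h0 : ∀ ξ, ‖F 0 ξ - Real.exp (-(ξ ^ 2 / 2))‖ ≤ K * |ξ| ^ (2 + δ))
    {t : ℝ} (ht : 0 ≤ t) (ξ : ℝ) :
    ‖F t ξ - Real.exp (-((|ξ| * Real.exp (-(coolingRate p q * t))) ^ 2 / 2))‖
      ≤ K * (|ξ| * Real.exp (-(coolingRate p q * t))) ^ (2 + δ) := by
  -- `ra s x` is the scaled size of the frequency `x` at time `s`, and `N` the shrinking Gaussian.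
  set l := coolingRate p q with hl
  have hl0 : 0 ≤ 2 * l := by rw [hl, coolingRate]; linarith
  have hl1 : 2 * l ≤ 1 := by rw [hl, coolingRate]; nlinarith
  set ra : ℝ → ℝ → ℝ := fun s x => |x| * Real.exp (-(l * s)) with hra
  set N : ℝ → ℝ → ℝ := fun s x => Real.exp (-((ra s x) ^ 2 / 2)) with hN
  have hra0 : ∀ s x, 0 ≤ ra s x := fun s x => by simp only [hra]; positivity
  have hN1 : ∀ s x, ‖(N s x : ℂ)‖ ≤ 1 := fun s x => by
    rw [Complex.norm_real, Real.norm_of_nonneg (Real.exp_pos _).le]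
    exact Real.exp_le_one_iff.2 (by have := sq_nonneg (ra s x); linarith)
  have hscale : ∀ a, 0 < a → ∀ s x, ra s (a * x) = a * ra s x := fun a ha s x => by
    simp only [hra, abs_mul, abs_of_pos ha]; ring
  have hrader : ∀ x s, HasDerivAt (fun s => ra s x) (-l * ra s x) s := fun x s => by
    have h1 : HasDerivAt (fun s : ℝ => -(l * s)) (-l) s := by
      simpa using ((hasDerivAt_id' s).const_mul l).fun_neg
    exact (h1.exp.const_mul |x|).congr_deriv (by simp only [hra]; ring)
  have hNder : ∀ x s, HasDerivAt (fun s => N s x) (2 * l * (ra s x) ^ 2 / 2 * N s x) s :=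
    fun x s => by
      exact (((hrader x s).fun_pow 2).div_const 2).fun_neg.exp.congr_deriv
        (by simp only [hN]; push_cast; ring)
  have hAder : ∀ x s, HasDerivAt (fun s => K * (ra s x) ^ (2 + δ))
      (-(l * (2 + δ)) * (K * (ra s x) ^ (2 + δ))) s := fun x s => by
    have e : ∀ s, ra s x ^ (2 + δ) = |x| ^ (2 + δ) * Real.exp (-(l * s) * (2 + δ)) := fun s => by
      simp only [hra]
      rw [Real.mul_rpow (abs_nonneg _) (Real.exp_pos _).le, ← Real.exp_mul]
    simp only [e]
    have h1 : HasDerivAt (fun s : ℝ => -(l * s) * (2 + δ)) (-(l * (2 + δ))) s := by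
      exact (((hasDerivAt_id' s).const_mul l).fun_neg.mul_const (2 + δ)).congr_deriv (by ring)
    exact ((h1.exp.const_mul (|x| ^ (2 + δ))).const_mul K).congr_deriv (by ring)
  have hprod : ∀ s x, N s (p * x) * N s (q * x)
      = Real.exp (-((1 - 2 * l) * ((ra s x) ^ 2 / 2))) := fun s x => by
    simp only [hN, hscale p hp, hscale q hq]
    rw [← Real.exp_add, hl, coolingRate]; ring_nf
  -- It is not known beforehand that the difference is `O(r ^ (2 + δ))` at positive times. The crude
  -- bound `2` is available, and each use of the equation shrinks the surplus over
  -- `K r ^ (2 + δ)` by `2 / 3`, because `ε = exp (2 t)` satisfies `ε + ε' = 3 ε` while the two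
  -- factors of the gain term contribute `2 ε`.
  have hiter : ∀ n : ℕ, ∀ t, 0 ≤ t → ∀ x, ‖F t x - N t x‖
      ≤ K * (ra t x) ^ (2 + δ) + 2 * (2 / 3) ^ n * Real.exp (2 * t) := by
    intro n
    induction n with
    | zero =>
      intro t ht x
      have h1 := norm_sub_le (F t x) (N t x)
      have h2 := hF.norm_le_one t ht x
      have h3 := hN1 t x
      have h4 : (1 : ℝ) ≤ Real.exp (2 * t) := Real.one_le_exp (by linarith)
      have h5 : 0 ≤ K * (ra t x) ^ (2 + δ) := mul_nonneg hK0 (Real.rpow_nonneg (hra0 t x) _)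
      simp only [pow_zero]
      linarith
    | succ n ih =>
      intro t ht x
      have hexp : ∀ s, HasDerivAt (fun s : ℝ => Real.exp (2 * s)) (2 * Real.exp (2 * s)) s :=
        fun s => by
          exact ((hasDerivAt_id' s).const_mul 2).exp.congr_deriv (by ring)
      refine norm_le_of_relaxation (u := fun s => F s x - N s x)
        (G := fun s => F s (p * x) * F s (q * x) - N s x
          - ((2 * l * (ra s x) ^ 2 / 2 * N s x : ℝ) : ℂ))
        (b := fun s => K * (ra s x) ^ (2 + δ) + 2 * (2 / 3) ^ (n + 1) * Real.exp (2 * s))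
        ht ?_ ?_ (fun s => (hAder x s).add ((hexp s).const_mul _)) ?_ ?_
      · refine ((hF.continuousOn x).mono Set.Icc_subset_Ici_self).sub ?_
        exact Complex.continuous_ofReal.comp_continuousOn
          fun s _ => (hNder x s).continuousAt.continuousWithinAt
      · intro s hs
        exact ((hF.hasDerivAt x s hs.1).sub (hNder x s).ofReal_comp).congr_deriv (by ring)
      · have h1 : N 0 x = Real.exp (-(x ^ 2 / 2)) := by simp [hN, hra]
        have h2 : ra 0 x = |x| := by simp [hra]
        simp only [h1, h2]
        have := h0 x
        have h3 : 0 ≤ 2 * (2 / 3 : ℝ) ^ (n + 1) * Real.exp (2 * 0) := by positivity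
        linarith
      · intro s hs
        have hP : 0 ≤ (ra s x) ^ (2 + δ) := Real.rpow_nonneg (hra0 s x) _
        have e : F s (p * x) * F s (q * x) - N s x - ((2 * l * (ra s x) ^ 2 / 2 * N s x : ℝ) : ℂ)
            = (F s (p * x) - N s (p * x)) * F s (q * x)
              + N s (p * x) * (F s (q * x) - N s (q * x))
              + ((N s (p * x) * N s (q * x) - N s x - 2 * l * (ra s x) ^ 2 / 2 * N s x : ℝ) : ℂ) := by
          push_cast; ring
        have h1 : ‖(F s (p * x) - N s (p * x)) * F s (q * x)‖ ≤ ‖F s (p * x) - N s (p * x)‖ := by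
          rw [norm_mul]
          exact mul_le_of_le_one_right (norm_nonneg _) (hF.norm_le_one s hs.1.le _)
        have h2 : ‖N s (p * x) * (F s (q * x) - N s (q * x))‖ ≤ ‖F s (q * x) - N s (q * x)‖ := by
          rw [norm_mul]
          exact mul_le_of_le_one_left (norm_nonneg _) (hN1 s _)
        have h3 : ‖((N s (p * x) * N s (q * x) - N s x
            - 2 * l * (ra s x) ^ 2 / 2 * N s x : ℝ) : ℂ)‖ ≤ (ra s x) ^ (2 + δ) := by
          rw [Complex.norm_real, hprod, Real.norm_eq_abs]
          exact gaussian_residual_le (hra0 s x) hδ hδ2 hl0 hl1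
        have h4 := ih s hs.1.le (p * x)
        have h5 := ih s hs.1.le (q * x)
        rw [hscale p hp, Real.mul_rpow hp.le (hra0 s x)] at h4
        rw [hscale q hq, Real.mul_rpow hq.le (hra0 s x)] at h5
        have h6 : (ra s x) ^ (2 + δ) ≤ K * -spectralS p q δ * (ra s x) ^ (2 + δ) :=
          le_mul_of_one_le_left hP hK
        rw [spectralS_eq, ← hl] at h6
        rw [e]
        refine (norm_add₃_le).trans ?_
        have h7 : (2 / 3 : ℝ) ^ (n + 1) = (2 / 3) ^ n * (2 / 3) := pow_succ _ _
        rw [h7]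
        linarith
  have hlim : Tendsto (fun n : ℕ => K * (ra t ξ) ^ (2 + δ) + 2 * (2 / 3) ^ n * Real.exp (2 * t))
      atTop (𝓝 (K * (ra t ξ) ^ (2 + δ) + 2 * 0 * Real.exp (2 * t))) :=
    (((tendsto_pow_atTop_nhds_zero_of_lt_one (by norm_num) (by norm_num)).const_mul 2).mul_const
      _).const_add _
  simp only [mul_zero, zero_mul, add_zero] at hlim
  exact ge_of_tendsto' hlim fun n => hiter n t ht ξ

/-! ### Fourier transforms of integrable functions -/

theorem integrable_kernel_mul {φ : ℝ → ℝ} (hφ : Integrable φ) (ξ : ℝ) :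
    Integrable fun v : ℝ => Complex.exp (-(Complex.I * (ξ : ℂ) * (v : ℂ))) * (φ v : ℂ) := by
  refine hφ.ofReal.bdd_mul (c := 1) (by fun_prop) (Eventually.of_forall fun v => ?_)
  rw [Complex.norm_exp]; simp

theorem norm_kernel (ξ v : ℝ) : ‖Complex.exp (-(Complex.I * (ξ : ℂ) * (v : ℂ)))‖ = 1 := by
  rw [Complex.norm_exp]; simp

theorem norm_hat_le {φ : ℝ → ℝ} (hφ : ∀ᵐ v : ℝ, 0 ≤ φ v) (ξ : ℝ) :
    ‖hat φ ξ‖ ≤ ∫ v : ℝ, φ v := by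
  refine (norm_integral_le_integral_norm _).trans (le_of_eq (integral_congr_ae ?_))
  filter_upwards [hφ] with v hv
  rw [norm_mul, norm_kernel, one_mul, Complex.norm_real, Real.norm_of_nonneg hv]

theorem integrable_cos_mul {φ : ℝ → ℝ} (hφ : Integrable φ) (ξ : ℝ) :
    Integrable fun v : ℝ => Real.cos (ξ * v) * φ v :=
  hφ.bdd_mul (c := 1) (by fun_prop) (Eventually.of_forall fun v => Real.abs_cos_le_one _)

theorem integrable_sin_mul {φ : ℝ → ℝ} (hφ : Integrable φ) (ξ : ℝ) :
    Integrable fun v : ℝ => Real.sin (ξ * v) * φ v :=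
  hφ.bdd_mul (c := 1) (by fun_prop) (Eventually.of_forall fun v => Real.abs_sin_le_one _)

theorem hat_eq {φ : ℝ → ℝ} (hφ : Integrable φ) (ξ : ℝ) :
    hat φ ξ = ((∫ v : ℝ, Real.cos (ξ * v) * φ v : ℝ) : ℂ)
      - ((∫ v : ℝ, Real.sin (ξ * v) * φ v : ℝ) : ℂ) * Complex.I := by
  rw [← integral_complex_ofReal, ← integral_complex_ofReal, ← integral_mul_const,
    ← integral_sub (integrable_cos_mul hφ ξ).ofReal ((integrable_sin_mul hφ ξ).ofReal.mul_const _)]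
  refine integral_congr_ae (Eventually.of_forall fun v => ?_)
  have : -(Complex.I * (ξ : ℂ) * (v : ℂ)) = ((-(ξ * v) : ℝ) : ℂ) * Complex.I := by
    push_cast; ring
  simp only [this, Complex.exp_mul_I, ← Complex.ofReal_cos, ← Complex.ofReal_sin, Real.cos_neg,
    Real.sin_neg]
  push_cast; ring

/-- The bounded continuous function `v ↦ cos (ξ v)`. -/
noncomputable def cosWave (ξ : ℝ) : ℝ →ᵇ ℝ :=
  BoundedContinuousFunction.ofNormedAddCommGroup (fun v => Real.cos (ξ * v)) (by fun_prop) 1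
    fun v => Real.abs_cos_le_one _

/-- The bounded continuous function `v ↦ sin (ξ v)`. -/
noncomputable def sinWave (ξ : ℝ) : ℝ →ᵇ ℝ :=
  BoundedContinuousFunction.ofNormedAddCommGroup (fun v => Real.sin (ξ * v)) (by fun_prop) 1
    fun v => Real.abs_sin_le_one _

theorem integral_sub_sub {a b c : ℝ → ℝ} (ha : Integrable a) (hb : Integrable b)
    (hc : Integrable c) :
    ∫ x : ℝ, (a x - b x - c x) = (∫ x : ℝ, a x) - (∫ x : ℝ, b x) - ∫ x : ℝ, c x := by
  have h : Integrable fun x => a x - b x := ha.sub hb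
  rw [integral_sub h hc, integral_sub ha hb]

theorem integral_add_sub {a b c : ℝ → ℝ} (ha : Integrable a) (hb : Integrable b)
    (hc : Integrable c) :
    ∫ x : ℝ, (a x + b x - c x) = (∫ x : ℝ, a x) + (∫ x : ℝ, b x) - ∫ x : ℝ, c x := by
  have h : Integrable fun x => a x + b x := ha.add hb
  rw [integral_sub h hc, integral_add ha hb]

/-! ### From weak solutions to the Fourier equation -/

section WeakSolution

variable {p q : ℝ} {f₀ : ℝ → ℝ} {f : ℝ → ℝ → ℝ}

theorem IsWeakSolution.continuousOn_integral (hf : IsWeakSolution p q f₀ f) (Φ : ℝ →ᵇ ℝ) :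
    ContinuousOn (fun t => ∫ v : ℝ, Φ v * f t v) (Set.Ici 0) := by
  intro t ht
  rcases (Set.mem_Ici.1 ht).eq_or_lt with h | h
  · subst h
    rw [← continuousWithinAt_Ioi_iff_Ici, ContinuousWithinAt]
    have e : ∫ v : ℝ, Φ v * f 0 v = ∫ v : ℝ, Φ v * f₀ v :=
      integral_congr_ae (hf.initial.mono fun v hv => by simp only [hv])
    rw [e]
    exact hf.initial_limit Φ
  · exact (hf.weak_form Φ t h).continuousAt.continuousWithinAt

theorem IsWeakSolution.mass_eq (hf : IsWeakSolution p q f₀ f) (h1 : ∫ v : ℝ, f₀ v = 1) {t : ℝ}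
    (ht : 0 ≤ t) : ∫ v : ℝ, f t v = 1 := by
  have hc := hf.continuousOn_integral (BoundedContinuousFunction.const ℝ 1)
  have hd := hf.weak_form (BoundedContinuousFunction.const ℝ 1)
  simp only [BoundedContinuousFunction.const_apply, one_mul, sub_self, mul_zero,
    integral_zero] at hc hd
  have key : ∫ v : ℝ, f t v = ∫ v : ℝ, f 0 v := by
    rcases ht.eq_or_lt with rfl | ht'
    · rfl
    · obtain ⟨c, -, hc'⟩ := exists_hasDerivAt_eq_slope _ _ ht'
        (hc.mono Set.Icc_subset_Ici_self) fun s hs => hd s hs.1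
      rw [sub_zero, eq_comm, div_eq_zero_iff] at hc'
      exact sub_eq_zero.1 (hc'.resolve_right ht'.ne')
  rw [key, integral_congr_ae hf.initial, h1]

/-- Testing the weak form with `cos (ξ v)` and `sin (ξ v)` gives the Fourier equation; conservation
of mass turns the loss term into `-F(ξ)` and gives the bound `‖F‖ ≤ 1`. -/
theorem IsWeakSolution.isFourierSolution (hf : IsWeakSolution p q f₀ f) (h1 : ∫ v : ℝ, f₀ v = 1) :
    IsFourierSolution p q fun t => hat (f t) := by
  refine ⟨fun t ht ξ => ?_, fun ξ => ?_, fun ξ t ht => ?_⟩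
  · exact (norm_hat_le (hf.nonneg t ht) ξ).trans_eq (hf.mass_eq h1 ht)
  · have h : ContinuousOn (fun t => ((∫ v : ℝ, cosWave ξ v * f t v : ℝ) : ℂ)
        - ((∫ v : ℝ, sinWave ξ v * f t v : ℝ) : ℂ) * Complex.I) (Set.Ici 0) :=
      (Complex.continuous_ofReal.comp_continuousOn (hf.continuousOn_integral _)).sub
        ((Complex.continuous_ofReal.comp_continuousOn (hf.continuousOn_integral _)).mul
          continuousOn_const)
    exact h.congr fun t ht => hat_eq (hf.integrable t ht) ξ
  · have hi := hf.integrable t ht.le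
    have hm := hf.mass_eq h1 ht.le
    have hcos := hf.weak_form (cosWave ξ) t ht
    have hsin := hf.weak_form (sinWave ξ) t ht
    set C : ℝ → ℝ := fun x => ∫ v : ℝ, Real.cos (x * v) * f t v with hC
    set S : ℝ → ℝ := fun x => ∫ v : ℝ, Real.sin (x * v) * f t v with hS
    have ic := integrable_cos_mul hi
    have is := integrable_sin_mul hi
    have ecos : ∫ v : ℝ, ∫ w : ℝ, f t v * f t w * (cosWave ξ (p * v + q * w) - cosWave ξ v)
        = C (p * ξ) * C (q * ξ) - S (p * ξ) * S (q * ξ) - C ξ := by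
      have inner : ∀ v, ∫ w : ℝ, f t v * f t w * (cosWave ξ (p * v + q * w) - cosWave ξ v)
          = Real.cos (p * ξ * v) * f t v * C (q * ξ) - Real.sin (p * ξ * v) * f t v * S (q * ξ)
            - Real.cos (ξ * v) * f t v := fun v => by
        have : ∀ w, f t v * f t w * (cosWave ξ (p * v + q * w) - cosWave ξ v)
            = Real.cos (p * ξ * v) * f t v * (Real.cos (q * ξ * w) * f t w)
              - Real.sin (p * ξ * v) * f t v * (Real.sin (q * ξ * w) * f t w)
              - Real.cos (ξ * v) * f t v * f t w := fun w => by
          change f t v * f t w * (Real.cos (ξ * (p * v + q * w)) - Real.cos (ξ * v)) = _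
          rw [show ξ * (p * v + q * w) = p * ξ * v + q * ξ * w by ring, Real.cos_add]
          ring
        simp only [this]
        rw [integral_sub_sub ((ic _).const_mul _) ((is _).const_mul _) (hi.const_mul _),
          integral_const_mul,
          integral_const_mul, integral_const_mul, hm, mul_one]
      simp only [inner]
      rw [integral_sub_sub ((ic _).mul_const _) ((is _).mul_const _) (ic _), integral_mul_const,
        integral_mul_const]
    have esin : ∫ v : ℝ, ∫ w : ℝ, f t v * f t w * (sinWave ξ (p * v + q * w) - sinWave ξ v)
        = S (p * ξ) * C (q * ξ) + C (p * ξ) * S (q * ξ) - S ξ := by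
      have inner : ∀ v, ∫ w : ℝ, f t v * f t w * (sinWave ξ (p * v + q * w) - sinWave ξ v)
          = Real.sin (p * ξ * v) * f t v * C (q * ξ) + Real.cos (p * ξ * v) * f t v * S (q * ξ)
            - Real.sin (ξ * v) * f t v := fun v => by
        have : ∀ w, f t v * f t w * (sinWave ξ (p * v + q * w) - sinWave ξ v)
            = Real.sin (p * ξ * v) * f t v * (Real.cos (q * ξ * w) * f t w)
              + Real.cos (p * ξ * v) * f t v * (Real.sin (q * ξ * w) * f t w)
              - Real.sin (ξ * v) * f t v * f t w := fun w => by
          change f t v * f t w * (Real.sin (ξ * (p * v + q * w)) - Real.sin (ξ * v)) = _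
          rw [show ξ * (p * v + q * w) = p * ξ * v + q * ξ * w by ring, Real.sin_add]
          ring
        simp only [this]
        rw [integral_add_sub ((ic _).const_mul _) ((is _).const_mul _) (hi.const_mul _),
          integral_const_mul,
          integral_const_mul, integral_const_mul, hm, mul_one]
      simp only [inner]
      rw [integral_add_sub ((is _).mul_const _) ((ic _).mul_const _) (is _), integral_mul_const,
        integral_mul_const]
    rw [ecos] at hcos
    rw [esin] at hsin
    have h := hcos.ofReal_comp.sub (hsin.ofReal_comp.mul_const Complex.I)
    have hev : (fun s => hat (f s) ξ) =ᶠ[𝓝 t] fun s => ((∫ v : ℝ, cosWave ξ v * f s v : ℝ) : ℂ)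
        - ((∫ v : ℝ, sinWave ξ v * f s v : ℝ) : ℂ) * Complex.I :=
      (lt_mem_nhds ht).mono fun s hs => hat_eq (hf.integrable s hs.le) ξ
    refine HasDerivAt.congr_of_eventuallyEq ?_ hev
    refine h.congr_deriv ?_
    rw [hat_eq hi, hat_eq hi, hat_eq hi]
    push_cast
    linear_combination (-(S (p * ξ) : ℂ) * S (q * ξ)) * Complex.I_sq

end WeakSolution

theorem hat_scaled (p q : ℝ) (f : ℝ → ℝ → ℝ) (t ξ : ℝ) :
    hat (scaled p q f t) ξ = hat (f t) (ξ * Real.exp (coolingRate p q * t)) := by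
  have hs : √(energy p q t) = Real.exp (-(coolingRate p q * t)) := by
    rw [energy, ← Real.exp_half]; congr 1; unfold coolingRate; ring
  set a := Real.exp (-(coolingRate p q * t)) with ha
  have ha0 : 0 < a := Real.exp_pos _
  have hinv : Real.exp (coolingRate p q * t) = a⁻¹ := by rw [ha, Real.exp_neg, inv_inv]
  unfold hat scaled
  rw [hs, hinv]
  have h := Measure.integral_comp_mul_right
    (fun u : ℝ => Complex.exp (-(Complex.I * ((ξ * a⁻¹ : ℝ) : ℂ) * (u : ℂ))) * (f t u : ℂ)) a
  rw [abs_of_pos (inv_pos.2 ha0), Complex.real_smul] at h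
  have hac : (a : ℂ) ≠ 0 := by exact_mod_cast ha0.ne'
  have h2 := congrArg (fun z : ℂ => (a : ℂ) * z) h
  simp only [Complex.ofReal_inv, mul_inv_cancel_left₀ hac] at h2
  rw [← integral_const_mul] at h2
  rw [← h2]
  refine integral_congr_ae (Eventually.of_forall fun v => ?_)
  have : Complex.I * ((ξ * (a : ℂ)⁻¹)) * ((v : ℂ) * a) = Complex.I * ξ * v := by
    field_simp
  simp only [Complex.ofReal_mul, Complex.ofReal_inv, this]
  ring

/-! ### Fourier transforms of probability densities -/

/-- Doubling inequality for characteristic functions. If `w` rotates `hat φ ξ` onto the positive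
half-line, it is the integral of `Re (z²) ≥ 4 Re z - 3` over the unimodular `z = w exp (-i ξ v)`. -/
theorem one_sub_norm_hat_two_mul_le {φ : ℝ → ℝ} (hnn : ∀ᵐ v : ℝ, 0 ≤ φ v) (hi : Integrable φ)
    (h1 : ∫ v : ℝ, φ v = 1) (ξ : ℝ) :
    1 - ‖hat φ (2 * ξ)‖ ≤ 4 * (1 - ‖hat φ ξ‖) := by
  obtain ⟨w, hw, hwu⟩ : ∃ w : ℂ, ‖w‖ = 1 ∧ (w * hat φ ξ).re = ‖hat φ ξ‖ := by
    obtain ⟨w, hw, h⟩ := RCLike.exists_norm_eq_mul_self (hat φ ξ)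
    exact ⟨w, hw, by rw [← h]; simp⟩
  have i1 := (integrable_kernel_mul hi ξ).const_mul w
  have i2 := (integrable_kernel_mul hi (2 * ξ)).const_mul (w ^ 2)
  have e1 : ‖hat φ ξ‖ = ∫ v : ℝ, (w * (Complex.exp (-(Complex.I * (ξ : ℂ) * (v : ℂ))) * φ v)).re := by
    rw [← hwu, hat, ← integral_const_mul]
    exact (Complex.reCLM.integral_comp_comm i1).symm
  have e2 : ∫ v : ℝ, (w ^ 2 * (Complex.exp (-(Complex.I * ((2 * ξ : ℝ) : ℂ) * (v : ℂ))) * φ v)).re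
      ≤ ‖hat φ (2 * ξ)‖ := by
    have : ∫ v : ℝ, (w ^ 2 * (Complex.exp (-(Complex.I * ((2 * ξ : ℝ) : ℂ) * (v : ℂ))) * φ v)).re
        = (w ^ 2 * hat φ (2 * ξ)).re := by
      rw [hat, ← integral_const_mul]
      exact Complex.reCLM.integral_comp_comm i2
    rw [this]
    refine (Complex.re_le_norm _).trans ?_
    simp [hw]
  have r1 : Integrable fun v : ℝ =>
      (w * (Complex.exp (-(Complex.I * (ξ : ℂ) * (v : ℂ))) * φ v)).re :=
    Complex.reCLM.integrable_comp i1
  have r2 : Integrable fun v : ℝ =>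
      (w ^ 2 * (Complex.exp (-(Complex.I * ((2 * ξ : ℝ) : ℂ) * (v : ℂ))) * φ v)).re :=
    Complex.reCLM.integrable_comp i2
  have e3 : ∫ v : ℝ, (4 * (w * (Complex.exp (-(Complex.I * (ξ : ℂ) * (v : ℂ))) * φ v)).re - 3 * φ v)
      ≤ ∫ v : ℝ, (w ^ 2 * (Complex.exp (-(Complex.I * ((2 * ξ : ℝ) : ℂ) * (v : ℂ))) * φ v)).re := by
    refine integral_mono_ae ((r1.const_mul 4).sub (hi.const_mul 3)) r2 ?_
    filter_upwards [hnn] with v hv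
    set z := w * Complex.exp (-(Complex.I * (ξ : ℂ) * (v : ℂ))) with hz
    have hz1 : ‖z‖ = 1 := by rw [hz, norm_mul, hw, norm_kernel, one_mul]
    have hz2 : w ^ 2 * (Complex.exp (-(Complex.I * ((2 * ξ : ℝ) : ℂ) * (v : ℂ))) * φ v)
        = z ^ 2 * φ v := by
      have : Complex.exp (-(Complex.I * ((2 * ξ : ℝ) : ℂ) * (v : ℂ)))
          = Complex.exp (-(Complex.I * (ξ : ℂ) * (v : ℂ))) ^ 2 := by
        rw [← Complex.exp_nat_mul]; push_cast; ring_nf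
      rw [this, hz]; ring
    have hn : z.re ^ 2 + z.im ^ 2 = 1 := by
      have := Complex.sq_norm z
      rw [hz1, Complex.normSq_apply] at this
      nlinarith
    have hzz : (z ^ 2).re = 2 * z.re ^ 2 - 1 := by
      rw [pow_two, Complex.mul_re]; nlinarith
    rw [hz2, ← mul_assoc, ← hz, Complex.re_mul_ofReal, Complex.re_mul_ofReal, hzz]
    nlinarith [mul_nonneg (sq_nonneg (z.re - 1)) hv]
  rw [integral_sub (r1.const_mul 4) (hi.const_mul 3), integral_const_mul, integral_const_mul, h1,
    ← e1] at e3
  linarith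

/-- A bound below `1` at infinity gives one on every `|ξ| ≥ ρ > 0`: doubling `ξ` a fixed number `n`
of times leads beyond `R`, at the cost of a factor `4 ^ n` in `1 - ‖hat φ ξ‖`. -/
theorem exists_norm_hat_le_of_decay {φ : ℝ → ℝ} (hnn : ∀ᵐ v : ℝ, 0 ≤ φ v) (hi : Integrable φ)
    (h1 : ∫ v : ℝ, φ v = 1) {R d ρ : ℝ} (hd : d < 1) (hρ : 0 < ρ)
    (hdec : ∀ ξ : ℝ, R < |ξ| → ‖hat φ ξ‖ ≤ d) :
    ∃ c < 1, ∀ ξ : ℝ, ρ ≤ |ξ| → ‖hat φ ξ‖ ≤ c := by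
  have hiter : ∀ (n : ℕ) (ξ : ℝ), 1 - ‖hat φ (2 ^ n * ξ)‖ ≤ 4 ^ n * (1 - ‖hat φ ξ‖) := by
    intro n
    induction n with
    | zero => intro ξ; simp
    | succ n ih =>
      intro ξ
      have h2 := one_sub_norm_hat_two_mul_le hnn hi h1 (2 ^ n * ξ)
      have h3 := ih ξ
      rw [pow_succ', pow_succ', mul_assoc, mul_assoc]
      linarith
  obtain ⟨n, hn⟩ := pow_unbounded_of_one_lt (R / ρ) (one_lt_two : (1 : ℝ) < 2)
  rw [div_lt_iff₀ hρ] at hn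
  have h4 : (0 : ℝ) < 4 ^ n := by positivity
  refine ⟨1 - (1 - d) / 4 ^ n, by have := div_pos (sub_pos.2 hd) h4; linarith, fun ξ hξ => ?_⟩
  have hR : R < |2 ^ n * ξ| := by
    rw [abs_mul, abs_of_pos (by positivity : (0 : ℝ) < 2 ^ n)]
    exact hn.trans_le (by gcongr)
  have h5 := hdec _ hR
  have h6 := hiter n ξ
  have h7 : (1 - d) / 4 ^ n ≤ 1 - ‖hat φ ξ‖ := by
    rw [div_le_iff₀ h4]; linarith
  linarith

theorem norm_exp_taylor_le {δ : ℝ} (hδ : 0 ≤ δ) (hδ1 : δ ≤ 1) (x : ℝ) :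
    ‖Complex.exp (-(Complex.I * (x : ℂ))) - 1 + Complex.I * x + (x : ℂ) ^ 2 / 2‖
      ≤ 4 * |x| ^ (2 + δ) := by
  have hz : ‖-(Complex.I * (x : ℂ))‖ = |x| := by simp
  rcases le_total |x| 1 with h | h
  · have h1 := Complex.exp_bound (x := -(Complex.I * (x : ℂ))) (by rwa [hz]) (n := 3) (by norm_num)
    have e : Complex.exp (-(Complex.I * (x : ℂ)))
        - ∑ m ∈ Finset.range 3, (-(Complex.I * (x : ℂ))) ^ m / (m.factorial : ℂ)
        = Complex.exp (-(Complex.I * (x : ℂ))) - 1 + Complex.I * x + (x : ℂ) ^ 2 / 2 := by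
      simp only [Finset.sum_range_succ, Finset.sum_range_zero, Nat.factorial]
      push_cast
      linear_combination (-(x : ℂ) ^ 2 / 2) * Complex.I_sq
    rw [e, hz] at h1
    have h3 : |x| ^ 3 ≤ |x| ^ (2 + δ) := by
      rcases (abs_nonneg x).eq_or_lt with h0 | h0
      · rw [← h0, Real.zero_rpow (by linarith)]; norm_num
      · rw [← Real.rpow_natCast]
        exact Real.rpow_le_rpow_of_exponent_ge h0 h (by push_cast; linarith)
    have h4 : 0 ≤ |x| ^ 3 := by positivity
    norm_num [Nat.factorial] at h1
    linarith
  · have h1 : ‖Complex.exp (-(Complex.I * (x : ℂ)))‖ = 1 := by rw [Complex.norm_exp]; simp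
    have h2 : ‖Complex.I * (x : ℂ)‖ = |x| := by simp
    have h3 : ‖(x : ℂ) ^ 2 / 2‖ = |x| ^ 2 / 2 := by simp
    have h4 : |x| ^ 2 ≤ |x| ^ (2 + δ) := by
      rw [← Real.rpow_natCast]
      exact Real.rpow_le_rpow_of_exponent_le h (by push_cast; linarith)
    have h5 := norm_add_le (Complex.exp (-(Complex.I * (x : ℂ))) - 1 + Complex.I * x)
      ((x : ℂ) ^ 2 / 2)
    have h6 := norm_add_le (Complex.exp (-(Complex.I * (x : ℂ))) - 1) (Complex.I * x)
    have h7 := norm_sub_le (Complex.exp (-(Complex.I * (x : ℂ)))) 1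
    rw [norm_one] at h7
    nlinarith

theorem abs_exp_neg_taylor_le {δ : ℝ} (hδ : 0 ≤ δ) (hδ1 : δ ≤ 2) (x : ℝ) :
    |Real.exp (-(x ^ 2 / 2)) - 1 + x ^ 2 / 2| ≤ |x| ^ (2 + δ) := by
  set z := x ^ 2 / 2 with hzd
  have hz0 : 0 ≤ z := by positivity
  have hnn : 0 ≤ Real.exp (-z) - 1 + z := by
    have := Real.add_one_le_exp (-z); linarith
  rw [abs_of_nonneg hnn]
  have hx2 : |x| ^ 2 = x ^ 2 := sq_abs x
  rcases le_total |x| 1 with h | h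
  · have h4 : |x| ^ 4 ≤ |x| ^ (2 + δ) := by
      rcases (abs_nonneg x).eq_or_lt with h0 | h0
      · rw [← h0, Real.zero_rpow (by linarith)]; norm_num
      · rw [← Real.rpow_natCast]
        exact Real.rpow_le_rpow_of_exponent_ge h0 h (by push_cast; linarith)
    have h5 : |x| ^ 4 = (x ^ 2) ^ 2 := by rw [← hx2]; ring
    have hz1 : |-z| ≤ 1 := by
      rw [abs_neg, abs_of_nonneg hz0, hzd, ← hx2]; nlinarith [abs_nonneg x]
    have h6 := (le_abs_self _).trans (Real.abs_exp_sub_one_sub_id_le hz1)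
    have h7 : (-z) ^ 2 = (x ^ 2) ^ 2 / 4 := by rw [hzd]; ring
    nlinarith [sq_nonneg (x ^ 2)]
  · have h4 : |x| ^ 2 ≤ |x| ^ (2 + δ) := by
      rw [← Real.rpow_natCast]
      exact Real.rpow_le_rpow_of_exponent_le h (by push_cast; linarith)
    have h5 : Real.exp (-z) ≤ 1 := Real.exp_le_one_iff.2 (by linarith)
    rw [hx2] at h4
    nlinarith

/-- The Fourier transform of a normalized density agrees to second order at `0` with the standard
Gaussian; the error is controlled by the moment of order `2 + δ`. -/
theorem IsNormalizedDensity.exists_norm_hat_sub_gaussian_le {φ : ℝ → ℝ}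
    (hφ : IsNormalizedDensity φ) {δ : ℝ} (hδ : 0 ≤ δ) (hδ1 : δ ≤ 1)
    (hm : Integrable fun v : ℝ => |v| ^ (2 + δ) * φ v) :
    ∃ K, ∀ ξ : ℝ, ‖hat φ ξ - Real.exp (-(ξ ^ 2 / 2))‖ ≤ K * |ξ| ^ (2 + δ) := by
  refine ⟨4 * (∫ v : ℝ, |v| ^ (2 + δ) * φ v) + 1, fun ξ => ?_⟩
  have i0 := integrable_kernel_mul hφ.integrable ξ
  have i1 : Integrable fun v : ℝ => (φ v : ℂ) := hφ.integrable.ofReal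
  have i2 : Integrable fun v : ℝ => Complex.I * (ξ : ℂ) * ((v * φ v : ℝ) : ℂ) :=
    hφ.integrable_mean.ofReal.const_mul _
  have i3 : Integrable fun v : ℝ => (ξ : ℂ) ^ 2 / 2 * ((v ^ 2 * φ v : ℝ) : ℂ) :=
    hφ.integrable_energy.ofReal.const_mul _
  have i01 : Integrable fun v : ℝ =>
      Complex.exp (-(Complex.I * (ξ : ℂ) * (v : ℂ))) * (φ v : ℂ) - (φ v : ℂ) := i0.sub i1
  have i012 : Integrable fun v : ℝ =>
      Complex.exp (-(Complex.I * (ξ : ℂ) * (v : ℂ))) * (φ v : ℂ) - (φ v : ℂ)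
        + Complex.I * (ξ : ℂ) * ((v * φ v : ℝ) : ℂ) := i01.add i2
  have e : hat φ ξ - 1 + (ξ : ℂ) ^ 2 / 2 = ∫ v : ℝ,
      (Complex.exp (-(Complex.I * ((ξ * v : ℝ) : ℂ))) - 1 + Complex.I * ((ξ * v : ℝ) : ℂ)
        + ((ξ * v : ℝ) : ℂ) ^ 2 / 2) * (φ v : ℂ) := by
    have : ∀ v : ℝ, (Complex.exp (-(Complex.I * ((ξ * v : ℝ) : ℂ))) - 1
        + Complex.I * ((ξ * v : ℝ) : ℂ) + ((ξ * v : ℝ) : ℂ) ^ 2 / 2) * (φ v : ℂ)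
        = Complex.exp (-(Complex.I * (ξ : ℂ) * (v : ℂ))) * (φ v : ℂ) - (φ v : ℂ)
          + Complex.I * (ξ : ℂ) * ((v * φ v : ℝ) : ℂ)
          + (ξ : ℂ) ^ 2 / 2 * ((v ^ 2 * φ v : ℝ) : ℂ) := fun v => by
      push_cast; rw [mul_assoc Complex.I]; ring
    simp only [this]
    rw [integral_add i012 i3, integral_add i01 i2, integral_sub i0 i1,
      integral_const_mul, integral_const_mul, integral_complex_ofReal, integral_complex_ofReal,
      integral_complex_ofReal, hφ.mass, hφ.mean, hφ.energy, ← hat]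
    push_cast; ring
  have h1 : ‖hat φ ξ - 1 + (ξ : ℂ) ^ 2 / 2‖
      ≤ 4 * (∫ v : ℝ, |v| ^ (2 + δ) * φ v) * |ξ| ^ (2 + δ) := by
    have e2 : 4 * (∫ v : ℝ, |v| ^ (2 + δ) * φ v) * |ξ| ^ (2 + δ)
        = ∫ v : ℝ, 4 * |ξ| ^ (2 + δ) * (|v| ^ (2 + δ) * φ v) := by
      rw [integral_const_mul]; ring
    rw [e, e2]
    refine norm_integral_le_of_norm_le (hm.const_mul _) ?_
    filter_upwards [hφ.nonneg] with v hv
    rw [norm_mul, Complex.norm_real, Real.norm_of_nonneg hv]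
    have := norm_exp_taylor_le hδ hδ1 (ξ * v)
    rw [abs_mul, Real.mul_rpow (abs_nonneg _) (abs_nonneg _)] at this
    calc _ ≤ 4 * (|ξ| ^ (2 + δ) * |v| ^ (2 + δ)) * φ v := by gcongr
      _ = _ := by ring
  have h2 := abs_exp_neg_taylor_le hδ (by linarith) ξ
  have e3 : hat φ ξ - Real.exp (-(ξ ^ 2 / 2)) = (hat φ ξ - 1 + (ξ : ℂ) ^ 2 / 2)
      - ((Real.exp (-(ξ ^ 2 / 2)) - 1 + ξ ^ 2 / 2 : ℝ) : ℂ) := by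
    push_cast; ring
  rw [e3]
  refine (norm_sub_le _ _).trans ?_
  rw [Complex.norm_real, Real.norm_eq_abs]
  linarith

/-! ### Low-frequency and high-frequency bounds -/

/-- The constant `1 / 8` is one that works: for `x ≤ 1` the Gaussian is at most `1 - x² / 4`, and
for small `x` the error `K x ^ (2 + δ)` uses up at most `x² / 8` of it. -/
theorem exists_lowFrequency_radius {δ K : ℝ} (hδ : 0 < δ) (hK : 0 < K) :
    ∃ ρ, 0 < ρ ∧ ∀ x : ℝ, 0 ≤ x → x ≤ ρ →
      Real.exp (-(x ^ 2 / 2)) + K * x ^ (2 + δ) ≤ 1 / (1 + 1 / 8 * x ^ 2) := by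
  refine ⟨min 1 ((1 / (8 * K)) ^ (1 / δ)), by positivity, fun x hx hxρ => ?_⟩
  have hx1 : x ≤ 1 := hxρ.trans (min_le_left _ _)
  have hKx : K * x ^ δ ≤ 1 / 8 := by
    have h1 : x ^ δ ≤ ((1 / (8 * K)) ^ (1 / δ)) ^ δ :=
      Real.rpow_le_rpow hx (hxρ.trans (min_le_right _ _)) hδ.le
    rw [← Real.rpow_mul (by positivity), one_div_mul_cancel hδ.ne', Real.rpow_one] at h1
    calc K * x ^ δ ≤ K * (1 / (8 * K)) := by gcongr
      _ = 1 / 8 := by field_simp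
  have hsplit : x ^ (2 + δ) = x ^ 2 * x ^ δ := by
    rw [Real.rpow_add_of_nonneg hx (by norm_num) hδ.le]; norm_cast
  have h2 : K * x ^ (2 + δ) ≤ x ^ 2 / 8 := by
    rw [hsplit]; nlinarith [sq_nonneg x]
  have hx2 : x ^ 2 ≤ 1 := by nlinarith
  have h3 : Real.exp (-(x ^ 2 / 2)) ≤ 1 - x ^ 2 / 2 + x ^ 2 / 4 := by
    have h4 : |-(x ^ 2 / 2)| ≤ 1 := by rw [abs_neg, abs_of_nonneg (by positivity)]; linarith
    have h5 := (le_abs_self _).trans (Real.abs_exp_sub_one_sub_id_le h4)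
    nlinarith [sq_nonneg x]
  rw [le_div_iff₀ (by positivity)]
  have h6 : Real.exp (-(x ^ 2 / 2)) + K * x ^ (2 + δ) ≤ 1 - x ^ 2 / 8 := by linarith
  nlinarith [sq_nonneg x, sq_nonneg (x ^ 2)]

/-- Uniform bound away from zero frequency: propagation with a constant barrier `c < 1`. If `pξ` is
still a high frequency the induction applies to `F(pξ)`; otherwise its scaled size is between
`q ρ` and `ρ`, where the low-frequency bound is below `c`. The conclusion includes this
intermediate range. -/
theorem IsFourierSolution.norm_le_const {p q ρ r k c : ℝ} {F : ℝ → ℝ → ℂ}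
    (hF : IsFourierSolution p q F) (hq : 0 < q) (hqp : q ≤ p) (hp1 : p < 1) (hρ : 0 < ρ)
    (hr : 0 ≤ r) (hk : 0 < k)
    (hlow : ∀ t, 0 ≤ t → ∀ ξ, |ξ| * Real.exp (-(r * t)) ≤ ρ →
      ‖F t ξ‖ ≤ 1 / (1 + k * (|ξ| * Real.exp (-(r * t))) ^ 2))
    (hc : 1 / (1 + k * (q * ρ) ^ 2) ≤ c) (h0 : ∀ ξ, ρ < |ξ| → ‖F 0 ξ‖ ≤ c)
    {t : ℝ} (ht : 0 ≤ t) {ξ : ℝ} (hξ : q * ρ ≤ |ξ| * Real.exp (-(r * t))) :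
    ‖F t ξ‖ ≤ c := by
  have hp : 0 < p := hq.trans_le hqp
  have hlow' : ∀ t, 0 ≤ t → ∀ ξ, q * ρ ≤ |ξ| * Real.exp (-(r * t)) →
      |ξ| * Real.exp (-(r * t)) ≤ ρ → ‖F t ξ‖ ≤ c := fun t ht ξ h1 h2 =>
    (hlow t ht ξ h2).trans (le_trans (by gcongr) hc)
  rcases le_or_gt (|ξ| * Real.exp (-(r * t))) ρ with h | h
  · exact hlow' t ht ξ hξ h
  refine hF.propagate hp hp1 hρ hr (V := fun _ => c) antitoneOn_const h0 ?_ ht h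
  intro t ht ξ hξ hind
  rw [norm_mul]
  have e : p * (|ξ| * Real.exp (-(r * t))) = |p * ξ| * Real.exp (-(r * t)) := by
    rw [abs_mul, abs_of_pos hp, mul_assoc]
  refine (mul_le_of_le_one_right (norm_nonneg _) (hF.norm_le_one t ht _)).trans ?_
  rcases le_or_gt (p * (|ξ| * Real.exp (-(r * t)))) ρ with h | h
  · refine hlow' t ht _ ?_ (e ▸ h)
    rw [← e]
    exact mul_le_mul hqp hξ.le hρ.le hp.le
  · exact hind h

/-- Polynomial decay at high frequency: propagation with the barrier `(1 + β x) ^ (-ν)`. Passing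
from `x` to `p x` costs at most the factor `p ^ (-ν)`, which the uniform bound `‖F(qξ)‖ ≤ c`
compensates since `c ≤ p ^ ν`. -/
theorem IsFourierSolution.norm_le_rpow {p q ρ r k c β ν : ℝ} {F : ℝ → ℝ → ℂ}
    (hF : IsFourierSolution p q F) (hq : 0 < q) (hqp : q ≤ p) (hp1 : p < 1) (hρ : 0 < ρ)
    (hr : 0 ≤ r) (hk : 0 < k)
    (hlow : ∀ t, 0 ≤ t → ∀ ξ, |ξ| * Real.exp (-(r * t)) ≤ ρ →
      ‖F t ξ‖ ≤ 1 / (1 + k * (|ξ| * Real.exp (-(r * t))) ^ 2))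
    (hc : 1 / (1 + k * (q * ρ) ^ 2) ≤ c) (h0 : ∀ ξ, ρ < |ξ| → ‖F 0 ξ‖ ≤ c)
    (hβ : 0 < β) (hν : 0 < ν) (hcp : c ≤ p ^ ν) (hcβ : c ≤ 1 / (1 + β * (ρ / p)) ^ ν)
    (hdecay : ∀ ξ, ρ < |ξ| → ‖F 0 ξ‖ ≤ 1 / (1 + β * |ξ|) ^ ν)
    {t : ℝ} (ht : 0 ≤ t) {ξ : ℝ} (hξ : ρ < |ξ| * Real.exp (-(r * t))) :
    ‖F t ξ‖ ≤ 1 / (1 + β * (|ξ| * Real.exp (-(r * t)))) ^ ν := by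
  have hp : 0 < p := hq.trans_le hqp
  have hanti : ∀ {x y : ℝ}, 0 ≤ x → x ≤ y → 1 / (1 + β * y) ^ ν ≤ 1 / (1 + β * x) ^ ν := by
    intro x y hx hxy
    have hy : 0 ≤ y := hx.trans hxy
    gcongr
  refine hF.propagate hp hp1 hρ hr (V := fun x => 1 / (1 + β * x) ^ ν)
    (fun x hx y _ hxy => hanti (hρ.trans hx).le hxy) hdecay ?_ ht hξ
  intro t ht ξ hξ hind
  set x := |ξ| * Real.exp (-(r * t)) with hx
  have hx0 : 0 < x := hρ.trans hξ
  have hFq : ‖F t (q * ξ)‖ ≤ c := by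
    refine hF.norm_le_const hq hqp hp1 hρ hr hk hlow hc h0 ht ?_
    rw [abs_mul, abs_of_pos hq, mul_assoc, ← hx]
    gcongr
  rw [norm_mul]
  rcases le_or_gt (p * x) ρ with h | h
  · calc ‖F t (p * ξ)‖ * ‖F t (q * ξ)‖ ≤ 1 * c := by
          gcongr
          exact hF.norm_le_one t ht _
      _ = c := one_mul c
      _ ≤ 1 / (1 + β * (ρ / p)) ^ ν := hcβ
      _ ≤ 1 / (1 + β * x) ^ ν := hanti hx0.le (by rwa [le_div_iff₀ hp, mul_comm])
  · have h1 := hind h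
    calc ‖F t (p * ξ)‖ * ‖F t (q * ξ)‖ ≤ 1 / (1 + β * (p * x)) ^ ν * p ^ ν := by
          gcongr
          exact hFq.trans hcp
      _ = 1 / ((1 + β * (p * x)) / p) ^ ν := by
          rw [Real.div_rpow (by positivity) hp.le, one_div_div, one_div_mul_eq_div]
      _ ≤ 1 / (1 + β * x) ^ ν := by
          gcongr
          rw [le_div_iff₀ hp]
          linarith

/-- A slow enough decay profile: it loses at most the factor `c` under `x ↦ p x` and stays above `c`
on `[0, L]`. -/
theorem exists_decay_parameters {p c L β ν : ℝ} (hp : 0 < p) (hp1 : p < 1) (hc : 0 < c)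
    (hc1 : c < 1) (hL : 0 < L) (hβ : 0 < β) (hν : 0 < ν) :
    ∃ β' ν', 0 < β' ∧ β' ≤ β ∧ 0 < ν' ∧ ν' ≤ ν ∧ c ≤ p ^ ν' ∧
      ∀ x, 0 ≤ x → x ≤ L → c ≤ 1 / (1 + β' * x) ^ ν' := by
  have hlogp : Real.log p < 0 := Real.log_neg hp hp1
  have hlogc : Real.log c < 0 := Real.log_neg hc hc1
  have hc' : 0 < 1 / c - 1 := by rw [sub_pos, lt_div_iff₀ hc]; linarith
  -- `p ^ (log c / log p) = c` fixes the exponent; with exponent at most `1`, the requirement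
  -- on `[0, L]` follows from `1 + β' L ≤ 1 / c`.
  refine ⟨min β ((1 / c - 1) / L), min (min ν 1) (Real.log c / Real.log p),
    lt_min hβ (div_pos hc' hL), min_le_left _ _,
    lt_min (lt_min hν one_pos) (div_pos_of_neg_of_neg hlogc hlogp),
    (min_le_left _ _).trans (min_le_left _ _), ?_, fun x hx hxL => ?_⟩
  · calc c = p ^ (Real.log c / Real.log p) := by
          rw [Real.rpow_def_of_pos hp, mul_div_cancel₀ _ hlogp.ne, Real.exp_log hc]
      _ ≤ _ := Real.rpow_le_rpow_of_exponent_ge hp hp1.le (min_le_right _ _)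
  · set β' := min β ((1 / c - 1) / L)
    set ν' := min (min ν 1) (Real.log c / Real.log p)
    have hβ' : 0 < β' := lt_min hβ (div_pos hc' hL)
    have h1 : β' * x ≤ 1 / c - 1 := by
      calc β' * x ≤ (1 / c - 1) / L * L := by
            gcongr
            exact min_le_right _ _
        _ = 1 / c - 1 := div_mul_cancel₀ _ hL.ne'
    have hb : 1 ≤ 1 + β' * x := by have := mul_nonneg hβ'.le hx; linarith
    have h2 : (1 + β' * x) ^ ν' ≤ 1 / c := by
      calc (1 + β' * x) ^ ν' ≤ (1 + β' * x) ^ (1 : ℝ) :=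
            Real.rpow_le_rpow_of_exponent_le hb ((min_le_left _ _).trans (min_le_right _ _))
        _ ≤ 1 / c := by rw [Real.rpow_one]; linarith
    rw [le_div_iff₀ (by positivity)]
    rw [le_div_iff₀ hc] at h2
    linarith

/-! ### Intermediate moments and conclusion -/

theorem integrable_rpow_mul_of_le {φ : ℝ → ℝ} {δ δ' : ℝ} (hφ : Integrable φ)
    (hnn : ∀ᵐ v : ℝ, 0 ≤ φ v) (h2 : Integrable fun v : ℝ => v ^ 2 * φ v)
    (hδ : 0 ≤ δ) (hδδ' : δ ≤ δ') (hm : Integrable fun v : ℝ => |v| ^ (2 + δ') * φ v) :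
    Integrable fun v : ℝ => |v| ^ (2 + δ) * φ v := by
  refine (h2.add hm).mono' ?_ ?_
  · have hcont : Continuous fun v : ℝ => |v| ^ (2 + δ) :=
      continuous_abs.rpow_const fun _ => Or.inr (by linarith)
    exact hcont.aestronglyMeasurable.mul hφ.aestronglyMeasurable
  · filter_upwards [hnn] with v hv
    rw [Real.norm_of_nonneg (mul_nonneg (Real.rpow_nonneg (abs_nonneg v) _) hv), Pi.add_apply,
      ← add_mul]
    refine mul_le_mul_of_nonneg_right ?_ hv
    have e : v ^ 2 = |v| ^ (2 : ℝ) := by rw [← sq_abs]; norm_cast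
    have n1 : 0 ≤ |v| ^ (2 : ℝ) := Real.rpow_nonneg (abs_nonneg v) _
    have n2 : 0 ≤ |v| ^ (2 + δ') := Real.rpow_nonneg (abs_nonneg v) _
    rw [e]
    rcases le_total |v| 1 with h | h
    · have : |v| ^ (2 + δ) ≤ |v| ^ (2 : ℝ) := by
        rcases (abs_nonneg v).eq_or_lt with h0 | h0
        · rw [← h0, Real.zero_rpow (by linarith), Real.zero_rpow (by norm_num)]
        · exact Real.rpow_le_rpow_of_exponent_ge h0 h (by linarith)
      linarith
    · have : |v| ^ (2 + δ) ≤ |v| ^ (2 + δ') :=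
        Real.rpow_le_rpow_of_exponent_le h (by linarith)
      linarith

end DissipativeMaxwell

open DissipativeMaxwell

theorem theorem1p1 (p q δ' : ℝ) (hq : 0 < q) (hqp : q ≤ p) (hpq : p ^ 2 + q ^ 2 < 1)
    (hδ' : 0 < δ' ∧ δ' < 1)
    (hS : ∀ δ : ℝ, 0 < δ → δ < δ' → spectralS p q δ < 0)
    (g₀ : ℝ → ℝ) (hg₀ : IsNormalizedDensity g₀)
    (hmoment : Integrable fun v : ℝ => |v| ^ (2 + δ') * g₀ v)
    (R ν β : ℝ) (hR : 0 < R) (hν : 0 < ν) (hβ : 0 < β)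
    (hdecay : ∀ ξ : ℝ, R < |ξ| → ‖hat g₀ ξ‖ ≤ 1 / (1 + β * |ξ|) ^ ν) :
    ∃ ρ k β' ν' : ℝ, 0 < ρ ∧ 0 < k ∧ 0 < β' ∧ 0 < ν' ∧
      ∀ f : ℝ → ℝ → ℝ, IsWeakSolution p q g₀ f →
        ∀ t : ℝ, 0 ≤ t →
          (∀ ξ : ℝ, |ξ| ≤ ρ → ‖hat (scaled p q f t) ξ‖ ≤ 1 / (1 + k * ξ ^ 2)) ∧
          (∀ ξ : ℝ, ρ < |ξ| → ‖hat (scaled p q f t) ξ‖ ≤ 1 / (1 + β' * |ξ|) ^ ν') := by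
  have hp : 0 < p := hq.trans_le hqp
  have hp1 : p < 1 := by nlinarith
  have hr : 0 ≤ coolingRate p q := by unfold coolingRate; linarith
  obtain ⟨δ, hδ, hδδ'⟩ := exists_between hδ'.1
  have hSδ : 0 < -spectralS p q δ := neg_pos.2 (hS δ hδ hδδ')
  obtain ⟨K₀, hK₀⟩ := hg₀.exists_norm_hat_sub_gaussian_le hδ.le (hδδ'.trans hδ'.2).le
    (integrable_rpow_mul_of_le hg₀.integrable hg₀.nonneg hg₀.integrable_energy hδ.le hδδ'.le
      hmoment)
  set K := max K₀ (1 / -spectralS p q δ) with hKdef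
  have hK : 0 < K := lt_max_of_lt_right (one_div_pos.2 hSδ)
  have hKS : 1 ≤ K * -spectralS p q δ := by
    rw [← div_le_iff₀ hSδ]; exact le_max_right _ _
  have hinit : ∀ ξ : ℝ, ‖hat g₀ ξ - Real.exp (-(ξ ^ 2 / 2))‖ ≤ K * |ξ| ^ (2 + δ) := fun ξ =>
    (hK₀ ξ).trans (mul_le_mul_of_nonneg_right (le_max_left _ _)
      (Real.rpow_nonneg (abs_nonneg ξ) _))
  obtain ⟨ρ, hρ, hlowexp⟩ := exists_lowFrequency_radius hδ hK
  have hd : 1 / (1 + β * R) ^ ν < 1 := by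
    have hβR : 0 < β * R := mul_pos hβ hR
    rw [div_lt_one (by positivity)]
    exact Real.one_lt_rpow (by linarith) hν
  obtain ⟨c₀, hc₀, hc₀bd⟩ := exists_norm_hat_le_of_decay hg₀.nonneg hg₀.integrable hg₀.mass
    (R := R) hd hρ fun ξ hξ => (hdecay ξ hξ).trans (by gcongr)
  set c := max (1 / (1 + 1 / 8 * (q * ρ) ^ 2)) c₀ with hcdef
  have hc0 : 0 < c := lt_max_of_lt_left (by positivity)
  have hc1 : c < 1 := by
    refine max_lt ?_ hc₀
    rw [div_lt_one (by positivity)]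
    have : 0 < (q * ρ) ^ 2 := by positivity
    linarith
  have hinitc : ∀ ξ : ℝ, ρ < |ξ| → ‖hat g₀ ξ‖ ≤ c := fun ξ hξ =>
    (hc₀bd ξ hξ.le).trans (le_max_right _ _)
  obtain ⟨β', ν', hβ', hβ'β, hν', hν'ν, hcp, hcL⟩ := exists_decay_parameters hp hp1 hc0 hc1
    (lt_max_of_lt_left hR : 0 < max R (ρ / p)) hβ hν
  have hinitV : ∀ ξ : ℝ, ρ < |ξ| → ‖hat g₀ ξ‖ ≤ 1 / (1 + β' * |ξ|) ^ ν' := by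
    intro ξ hξ
    rcases le_or_gt |ξ| R with h | h
    · exact (hinitc ξ hξ).trans (hcL _ (abs_nonneg ξ) (h.trans (le_max_left _ _)))
    · refine (hdecay ξ h).trans ?_
      have hb : 0 ≤ β' * |ξ| := by positivity
      gcongr 1 / ?_
      calc (1 + β' * |ξ|) ^ ν' ≤ (1 + β' * |ξ|) ^ ν :=
            Real.rpow_le_rpow_of_exponent_le (by linarith) hν'ν
        _ ≤ (1 + β * |ξ|) ^ ν := by gcongr
  refine ⟨ρ, 1 / 8, β', ν', hρ, by norm_num, hβ', hν', fun f hf t ht => ?_⟩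
  have hF := hf.isFourierSolution hg₀.mass
  have hF0 : hat (f 0) = hat g₀ := by
    funext ξ
    exact integral_congr_ae (hf.initial.mono fun v hv => by simp only [hv])
  have hlow : ∀ t, 0 ≤ t → ∀ ξ, |ξ| * Real.exp (-(coolingRate p q * t)) ≤ ρ →
      ‖hat (f t) ξ‖ ≤ 1 / (1 + 1 / 8 * (|ξ| * Real.exp (-(coolingRate p q * t))) ^ 2) := by
    intro t ht ξ hξ
    have h1 := hF.norm_sub_gaussian_le hp hq hpq hδ.le (by linarith [hδ'.2]) hK.le hKS
      (fun ξ => by rw [hF0]; exact hinit ξ) ht ξ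
    refine le_trans ?_ (hlowexp _ (by positivity) hξ)
    set y := |ξ| * Real.exp (-(coolingRate p q * t))
    have h2 := norm_le_norm_add_norm_sub' (hat (f t) ξ) (Real.exp (-(y ^ 2 / 2)) : ℂ)
    rw [Complex.norm_real, Real.norm_of_nonneg (Real.exp_pos _).le] at h2
    linarith
  have hscale : ∀ ξ : ℝ, |ξ * Real.exp (coolingRate p q * t)|
      * Real.exp (-(coolingRate p q * t)) = |ξ| := fun ξ => by
    rw [abs_mul, Real.abs_exp, mul_assoc, ← Real.exp_add, add_neg_cancel, Real.exp_zero, mul_one]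
  refine ⟨fun ξ hξ => ?_, fun ξ hξ => ?_⟩
  · have h := hlow t ht (ξ * Real.exp (coolingRate p q * t)) (by rwa [hscale])
    rwa [hscale, sq_abs, ← hat_scaled] at h
  · have h := hF.norm_le_rpow hq hqp hp1 hρ hr (by norm_num : (0 : ℝ) < 1 / 8) hlow
      (le_max_left _ _) (fun ξ h => by rw [hF0]; exact hinitc ξ h) hβ' hν' hcp
      (hcL _ (by positivity) (le_max_right _ _)) (fun ξ h => by rw [hF0]; exact hinitV ξ h) ht
      (ξ := ξ * Real.exp (coolingRate p q * t)) (by rwa [hscale])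
    rwa [hscale, ← hat_scaled] at h
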